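/- **Setting.** Let $k\in(0,1)$ and $\rho_0>0$. Consider spherically symmetric metrics $$\mathbf g=-a\,b^2\,dv^2+2b\,dv\,dr+r^2(d\theta^2+\sin^2\theta\,d\varphi^2),\qquad a=a(v,r),\ b=b(v,r)>0,$$ and the Einstein–Euler equations $G_{\mu\nu}=8\pi T_{\mu\nu}$, $T_{\mu\nu}=(\rho+p)u_\mu u_\nu+p\,g_{\mu\nu}$, with $p=k^2\rho$, $\rho>0$ and a unit timelike velocity $u=u^0\partial_v+u^1\partial_r$, $u^0>0$. Put $M=b^2\rho\,(u^0)^2$ and $V=\frac{u^1}{b\,u^0}-\frac a2$. A *static solution with central density $\rho_0$* is a $v$-independent solution on $r>0$ with $a,b\in C^2((0,\infty))$, where $a,b,\rho$ are continuous on $[0,\infty)$ with $a(0)=b(0)=1$ and $\rho(0)=\rho_0$; write $(M^{(0)},V^{(0)},a^{(0)},b^{(0)})$ for its data. Let $r_*>0$, $\Delta\in(0,r_*)$, $\delta\in(0,\Delta)$, $h>0$. The *$(r_*,\delta,h)$-perturbed initial data* of a static solution are $M_0=M^{(0)}$, $b_0=b^{(0)}$, $V_0=V^{(0)}+V^{(1)}$,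 where $V^{(1)}=V^{(0)}/h$ on $[r_*-\delta,r_*+\delta]$ and $V^{(1)}=0$ elsewhere, and $$a_0(r)=1-\frac{4\pi(1+k^2)}{r}\int_0^r\frac{b_0(s)}{b_0(r)}M_0(s)\Big(2\,\frac{1-k^2}{1+k^2}|V_0(s)|+1\Big)s^2\,ds,\qquad a_0(0)=1.$$ The slice contains a trapped surface (a trapped symmetry sphere) if $a_0(r)<0$ for some $r>0$. The initial value of $\partial_v a$ is the one prescribed by the Einstein equation $G^r{}_v=8\pi T^r{}_v$: $$\partial_v a_0(r)=2\pi(1+k^2)\,r\,b_0(r)\,M_0(r)\,\big(a_0(r)^2-4V_0(r)^2\big).$$ **Theorem.** For all $k\in(0,1)$, $\rho_0>0$, $r_*>0$ and $\Delta\in(0,r_*)$ there are constants $C_1,C_2,C_3,C_4>0$, depending only on $k,\rho_0,r_*,\Delta$, such that for every static solution with central density $\rho_0$ and all $\delta\in(0,\Delta)$, $h>0$ with $\frac{\delta}{h}\le\frac1{C_1}$, the $(r_*,\delta,h)$-perturbed initial data satisfy $$0<a_0(r)\le a^{(0)}(r)\qquad\text{for all } r\ge 0$$ and $$\partial_v a_0(r)\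 \begin{cases}=0 & 0\le r<r_*-\delta,\\ <0 & r>r_*-\delta,\\ \le -C_2\,\frac{\delta}{h^3} & r_*-\delta\le r\le r_*+\delta,\\ \le -C_4\,\frac1{h^2} & r_*-\delta\le r\le r_*+\delta,\\ \le -C_3\,\frac{\delta}{h} & r_*+\delta<r\le r_*+\Delta.\end{cases}$$ In particular, the initial data contain no trapped surface, and $\partial_v a_0\ll0$ for suitable $\delta,h$: for every $N\in\mathbb R$ there are $\delta\in(0,\Delta)$ and $h>0$ with $\frac\delta h\le\frac1{C_1}$ such that, for every static solution with central density $\rho_0$, $\partial_v a_0\le -N$ on $[r_*-\delta,r_*+\delta]$. -/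

import Mathlib

open Set Filter Topology

noncomputable section

namespace EinsteinEuler

/-! ### Curvature in a coordinate chart

Points are coordinate vectors `x : Fin 4 → ℝ`; a metric is its matrix of components. -/

/-- Partial derivative with respect to the `i`-th coordinate. -/
def pd (i : Fin 4) (f : (Fin 4 → ℝ) → ℝ) (x : Fin 4 → ℝ) : ℝ :=
  deriv (fun t => f (Function.update x i t)) (x i)

/-- Christoffel symbols `Γ^i_{jk}` of the Levi-Civita connection. -/
def christoffel (g : (Fin 4 → ℝ) → Matrix (Fin 4) (Fin 4) ℝ) (i j k : Fin 4)
    (x : Fin 4 → ℝ) : ℝ :=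
  (1 / 2) * ∑ l, (g x)⁻¹ i l *
    (pd j (fun y => g y l k) x + pd k (fun y => g y l j) x - pd l (fun y => g y j k) x)

/-- Ricci curvature `R_{jk}`. -/
def ricci (g : (Fin 4 → ℝ) → Matrix (Fin 4) (Fin 4) ℝ) (j k : Fin 4) (x : Fin 4 → ℝ) : ℝ :=
  ∑ i, (pd i (christoffel g i j k) x - pd j (christoffel g i i k) x) +
  ∑ i, ∑ l, (christoffel g i i l x * christoffel g l j k x -
    christoffel g i j l x * christoffel g l i k x)

/-- Scalar curvature. -/
def scalarCurvature (g : (Fin 4 → ℝ) → Matrix (Fin 4) (Fin 4) ℝ) (x : Fin 4 → ℝ) : ℝ :=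
  ∑ i, ∑ j, (g x)⁻¹ i j * ricci g i j x

/-- Einstein tensor `G_{ij} = R_{ij} - R g_{ij} / 2`. -/
def einsteinTensor (g : (Fin 4 → ℝ) → Matrix (Fin 4) (Fin 4) ℝ) (i j : Fin 4)
    (x : Fin 4 → ℝ) : ℝ :=
  ricci g i j x - (1 / 2) * scalarCurvature g x * g x i j

/-- Energy-momentum tensor `T_{ij} = (ρ + p) u_i u_j + p g_{ij}` of a perfect fluid, at a point
where the metric has components `g` and the velocity has the contravariant components `u`. -/
def fluidTensor (g : Matrix (Fin 4) (Fin 4) ℝ) (ρ p : ℝ) (u : Fin 4 → ℝ) (i j : Fin 4) : ℝ :=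
  (ρ + p) * (g.mulVec u i) * (g.mulVec u j) + p * g i j

/-! ### Spherical symmetry in generalized Eddington-Finkelstein coordinates -/

/-- The metric `- a b² dv² + 2 b dv dr + r² (dθ² + sin² θ dφ²)`, with `a = a(v, r)` and
`b = b(v, r)`, in the coordinates `x = (v, r, θ, φ)`. -/
def efMetric (a b : ℝ → ℝ → ℝ) (x : Fin 4 → ℝ) : Matrix (Fin 4) (Fin 4) ℝ :=
  !![-(a (x 0) (x 1)) * (b (x 0) (x 1)) ^ 2, b (x 0) (x 1), 0, 0;
     b (x 0) (x 1), 0, 0, 0;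
     0, 0, (x 1) ^ 2, 0;
     0, 0, 0, (x 1) ^ 2 * (Real.sin (x 2)) ^ 2]

/-- The Einstein-Euler equations `G = 8 π T` with the linear equation of state `p = k² ρ`, away
from the axis, for a spherically symmetric metric and a fluid of density `ρ(v, r)` whose velocity
`u = u⁰ ∂_v + u¹ ∂_r` is a unit timelike vector with `u⁰ > 0`.
(The Euler equations `∇^i T_{ij} = 0` are the contracted Bianchi identity.) -/
def SolvesEinsteinEuler (k : ℝ) (a b ρ u0 u1 : ℝ → ℝ → ℝ) : Prop :=
  ∀ x : Fin 4 → ℝ, 0 < x 1 → x 2 ∈ Ioo 0 Real.pi →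
    0 < u0 (x 0) (x 1) ∧
    (∑ i, ∑ j, efMetric a b x i j * (![u0 (x 0) (x 1), u1 (x 0) (x 1), 0, 0] : Fin 4 → ℝ) i *
      (![u0 (x 0) (x 1), u1 (x 0) (x 1), 0, 0] : Fin 4 → ℝ) j = -1) ∧
    ∀ i j, einsteinTensor (efMetric a b) i j x =
      8 * Real.pi * fluidTensor (efMetric a b x) (ρ (x 0) (x 1)) (k ^ 2 * ρ (x 0) (x 1))
        ![u0 (x 0) (x 1), u1 (x 0) (x 1), 0, 0] i j

/-- A static solution with infinite extent, regular center, central density `ρ₀`, and the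
normalization `b(0) = 1` of the null coordinate: none of the quantities depends on `v`. -/
structure StaticSolution (k ρ₀ : ℝ) where
  a : ℝ → ℝ
  b : ℝ → ℝ
  ρ : ℝ → ℝ
  u0 : ℝ → ℝ
  u1 : ℝ → ℝ
  contDiff_a : ContDiffOn ℝ 2 a (Ioi 0)
  contDiff_b : ContDiffOn ℝ 2 b (Ioi 0)
  cont_a : ContinuousOn a (Ici 0)
  cont_b : ContinuousOn b (Ici 0)
  cont_ρ : ContinuousOn ρ (Ici 0)
  a_zero : a 0 = 1
  b_zero : b 0 = 1
  ρ_zero : ρ 0 = ρ₀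
  b_pos : ∀ r, 0 ≤ r → 0 < b r
  ρ_pos : ∀ r, 0 ≤ r → 0 < ρ r
  solves : SolvesEinsteinEuler k (fun _ r => a r) (fun _ r => b r) (fun _ r => ρ r)
    (fun _ r => u0 r) (fun _ r => u1 r)

/-- Data `(M, V, a, b)` on a slice `v = v₀`: normalized mass, normalized velocity and metric
coefficients, as functions of the area radius. -/
structure SliceData where
  M : ℝ → ℝ
  V : ℝ → ℝ
  a : ℝ → ℝ
  b : ℝ → ℝ

/-- The data `M = b² ρ (u⁰)²`, `V = u¹ / (b u⁰) - a / 2`, `a`, `b` of a static solution. -/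
def StaticSolution.data {k ρ₀ : ℝ} (S : StaticSolution k ρ₀) : SliceData where
  M := fun r => (S.b r) ^ 2 * S.ρ r * (S.u0 r) ^ 2
  V := fun r => S.u1 r / (S.b r * S.u0 r) - S.a r / 2
  a := S.a
  b := S.b

/-- The step-function perturbation of the normalized velocity. -/
def velocityStep (V : ℝ → ℝ) (rs δ h : ℝ) (r : ℝ) : ℝ :=
  if r < rs - δ then 0 else if r ≤ rs + δ then V r / h else 0

/-- The coefficient `a` determined by `M, V, b` through the integral representation that expresses
the Einstein equations on the slice (at `r = 0` the value is `1`, the limit at the center). -/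
def aIntegral (k : ℝ) (M V b : ℝ → ℝ) (r : ℝ) : ℝ :=
  1 - 4 * Real.pi * (1 + k ^ 2) / r *
    ∫ s in (0 : ℝ)..r, b s / b r * M s *
      (2 * ((1 - k ^ 2) / (1 + k ^ 2)) * |V s| + 1) * s ^ 2

/-- The `(r_*, δ, h)`-perturbed initial data of static data `D`. -/
def SliceData.perturbed (k : ℝ) (D : SliceData) (rs δ h : ℝ) : SliceData where
  M := D.M
  V := fun r => D.V r + velocityStep D.V rs δ h r
  a := aIntegral k D.M (fun r => D.V r + velocityStep D.V rs δ h r) D.b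
  b := D.b

/-- The initial value of `∂_v a`, which the data determine through the Einstein equation
`- (∂_v a) / r = G^r_v = 8 π T^r_v`, where
`T^r_v = (1 + k²) ρ u^r u_v = (1 + k²) b M (V² - a² / 4)`. -/
def SliceData.dva (k : ℝ) (D : SliceData) (r : ℝ) : ℝ :=
  2 * Real.pi * (1 + k ^ 2) * r * D.b r * D.M r * ((D.a r) ^ 2 - 4 * (D.V r) ^ 2)

/-- Some symmetry sphere of the slice is trapped: its outgoing null expansion, which has the sign
of `a`, is negative (the ingoing one always is). -/
def SliceData.HasTrappedSurface (D : SliceData) : Prop :=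
  ∃ r, 0 < r ∧ D.a r < 0

end EinsteinEuler

end

/-! The static field equations force `u1 = 0`, hence V = -a/2 and M = ρ/a, and they reduce to a
first order system for a, b, ρ (`StaticSolution.isStaticFluid`). In the integral for a₀ the
unperturbed part of |V| reproduces the static a exactly (`integral_staticSource`), and the step
contributes only a term linear in 1/h. So a₀ = a - d with d ≥ 0 of size at most const · δ/h
(`perturbed_a`, `massShift_le`).

For δ/h small, d stays below the uniform bound a ≥ 1/8, a Buchdahl-type inequality (`le_a`), so no
sphere is trapped. The sign of ∂_v a is that of a₀² - 4V². Before the step this vanishes. On the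
step, 4V² = a²(1 + 1/h)² while a₀ ≤ a, which leaves a negative term of order 1/h². Beyond the step,
4V² = a² and a₀² - a² ≤ -d a, of order δ/h.

The constants must serve all static solutions with the given ρ₀ at once. No uniqueness theorem is
used; instead a, bρ and ρ are bounded explicitly in terms of k, ρ₀ and the radius (`le_a`,
`ρ_mul_b_le`, `le_ρ`), each by a monotonicity argument for a suitable quantity
(`le_of_deriv_nonpos_of_lt`). -/

noncomputable section

namespace EinsteinEuler

/-! ### Curvature of the static metric. -/

/-- The coordinate domain away from the axes. -/
def chartDomain : Set (Fin 4 → ℝ) := {x | 0 < x 1 ∧ x 2 ∈ Ioo 0 Real.pi}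

/-- Partial derivatives of a function that depends on `(r, θ)` only. -/
theorem pd_eq_of_eqOn {f : (Fin 4 → ℝ) → ℝ} {F : ℝ → ℝ → ℝ}
    (hf : ∀ y ∈ chartDomain, f y = F (y 1) (y 2)) {x : Fin 4 → ℝ} (hx : x ∈ chartDomain)
    (i : Fin 4) :
    pd i f x = ![0, deriv (fun r => F r (x 2)) (x 1), deriv (fun θ => F (x 1) θ) (x 2), 0] i := by
  obtain ⟨hx1, hx2⟩ := hx
  have key : ∀ G : ℝ → ℝ, (∀ᶠ t in 𝓝 (x i), f (Function.update x i t) = G t) →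
      pd i f x = deriv G (x i) := fun G hG => Filter.EventuallyEq.deriv_eq hG
  fin_cases i
  · have := key (fun _ => F (x 1) (x 2)) (Eventually.of_forall fun t => by
      rw [hf]
      · simp
      · simpa [chartDomain] using ⟨hx1, hx2⟩)
    simpa using this
  · have := key (fun t => F t (x 2)) (by
      filter_upwards [lt_mem_nhds hx1] with t ht
      rw [hf]
      · simp
      · simpa [chartDomain] using ⟨ht, hx2⟩)
    simpa using this
  · have := key (fun t => F (x 1) t) (by
      filter_upwards [isOpen_Ioo.mem_nhds hx2] with t ht
      rw [hf]
      · simp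
      · simpa [chartDomain] using ⟨hx1, ht⟩)
    simpa using this
  · have := key (fun _ => F (x 1) (x 2)) (Eventually.of_forall fun t => by
      rw [hf]
      · simp
      · simpa [chartDomain] using ⟨hx1, hx2⟩)
    simpa using this

/-- The static metric with coefficients `a(r)` and `b(r)`. -/
abbrev staticMetric (a b : ℝ → ℝ) : (Fin 4 → ℝ) → Matrix (Fin 4) (Fin 4) ℝ :=
  efMetric (fun _ r => a r) (fun _ r => b r)

/-- Inverse of the static metric. -/
def staticInv (a b : ℝ → ℝ) (r θ : ℝ) : Matrix (Fin 4) (Fin 4) ℝ :=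
  !![0, 1 / b r, 0, 0;
     1 / b r, a r, 0, 0;
     0, 0, 1 / r ^ 2, 0;
     0, 0, 0, 1 / (r ^ 2 * Real.sin θ ^ 2)]

theorem staticMetric_inv {a b : ℝ → ℝ} {x : Fin 4 → ℝ} (hx : x ∈ chartDomain)
    (hb : b (x 1) ≠ 0) : (staticMetric a b x)⁻¹ = staticInv a b (x 1) (x 2) := by
  have hr : x 1 ≠ 0 := hx.1.ne'
  have hs : Real.sin (x 2) ≠ 0 := (Real.sin_pos_of_mem_Ioo hx.2).ne'
  apply Matrix.inv_eq_right_inv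
  ext i j
  fin_cases i <;> fin_cases j <;>
    simp [staticMetric, efMetric, staticInv, Matrix.mul_apply, Fin.sum_univ_four] <;>
    field_simp
  ring

/-- The coefficient `Γ^v_{vv}` of the static metric. -/
def redshift (a b : ℝ → ℝ) (r : ℝ) : ℝ := deriv a r * b r / 2 + a r * deriv b r

/-- Christoffel symbols of the static metric, as functions of `(r, θ)`. -/
def staticChristoffel (a b : ℝ → ℝ) (i j k : Fin 4) (r θ : ℝ) : ℝ :=
  (![!![redshift a b r, 0, 0, 0;
      0, 0, 0, 0;
      0, 0, -(r / b r), 0;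
      0, 0, 0, -(r * Real.sin θ ^ 2 / b r)],
    !![a r * b r * redshift a b r, -redshift a b r, 0, 0;
      -redshift a b r, deriv b r / b r, 0, 0;
      0, 0, -(a r * r), 0;
      0, 0, 0, -(a r * r * Real.sin θ ^ 2)],
    !![0, 0, 0, 0;
      0, 0, 1 / r, 0;
      0, 1 / r, 0, 0;
      0, 0, 0, -(Real.sin θ * Real.cos θ)],
    !![0, 0, 0, 0;
      0, 0, 0, 1 / r;
      0, 0, 0, Real.cos θ / Real.sin θ;
      0, 1 / r, Real.cos θ / Real.sin θ, 0]] : Fin 4 → Matrix (Fin 4) (Fin 4) ℝ) i j k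

/-- Components of the static metric, as functions of `(r, θ)`. -/
def staticComponents (a b : ℝ → ℝ) (i j : Fin 4) (r θ : ℝ) : ℝ :=
  !![-(a r) * (b r) ^ 2, b r, 0, 0;
     b r, 0, 0, 0;
     0, 0, r ^ 2, 0;
     0, 0, 0, r ^ 2 * (Real.sin θ) ^ 2] i j

theorem christoffel_static {a b : ℝ → ℝ} {x : Fin 4 → ℝ} (hx : x ∈ chartDomain)
    (ha : DifferentiableAt ℝ a (x 1)) (hb : DifferentiableAt ℝ b (x 1)) (hb0 : b (x 1) ≠ 0)
    (i j k : Fin 4) :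
    christoffel (staticMetric a b) i j k x = staticChristoffel a b i j k (x 1) (x 2) := by
  have hpd : ∀ l i j, pd l (fun y => staticMetric a b y i j) x = _ := fun l i j =>
    pd_eq_of_eqOn (F := staticComponents a b i j) (fun y _ => rfl) hx l
  have hr : x 1 ≠ 0 := hx.1.ne'
  have hs : Real.sin (x 2) ≠ 0 := (Real.sin_pos_of_mem_Ioo hx.2).ne'
  have d1 : deriv (fun r => a r * b r ^ 2) (x 1) =
      deriv a (x 1) * b (x 1) ^ 2 + a (x 1) * (2 * b (x 1) * deriv b (x 1)) := by
    refine (ha.hasDerivAt.fun_mul (hb.hasDerivAt.fun_pow 2)).deriv.trans ?_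
    simp
  have d2 : deriv (fun θ => Real.sin θ ^ 2) (x 2) = 2 * Real.sin (x 2) * Real.cos (x 2) := by
    simp
  unfold christoffel
  simp only [staticMetric_inv hx hb0, hpd]
  fin_cases i <;> fin_cases j <;> fin_cases k <;>
    simp [Fin.sum_univ_four, staticInv, staticComponents, staticChristoffel, d1, d2, redshift] <;>
    field_simp <;> ring

theorem ricci_static {a b : ℝ → ℝ} (ha : ContDiffOn ℝ 2 a (Ioi 0)) (hb : ContDiffOn ℝ 2 b (Ioi 0))
    (hb0 : ∀ r, 0 < r → b r ≠ 0) {x : Fin 4 → ℝ} (hx : x ∈ chartDomain) (j k : Fin 4) :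
    ricci (staticMetric a b) j k x =
      !![a (x 1) * b (x 1) * (deriv (redshift a b) (x 1) + 2 * redshift a b (x 1) / x 1),
          -(deriv (redshift a b) (x 1) + 2 * redshift a b (x 1) / x 1), 0, 0;
        -(deriv (redshift a b) (x 1) + 2 * redshift a b (x 1) / x 1),
          2 * deriv b (x 1) / (b (x 1) * x 1), 0, 0;
        0, 0, 1 - a (x 1) - x 1 * deriv a (x 1) - a (x 1) * x 1 * deriv b (x 1) / b (x 1), 0;
        0, 0, 0, (1 - a (x 1) - x 1 * deriv a (x 1) - a (x 1) * x 1 * deriv b (x 1) / b (x 1)) *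
          Real.sin (x 2) ^ 2] j k := by
  have da : ∀ r, 0 < r → DifferentiableAt ℝ a r := fun r hr =>
    (ha.contDiffAt (Ioi_mem_nhds hr)).differentiableAt (by norm_num)
  have db : ∀ r, 0 < r → DifferentiableAt ℝ b r := fun r hr =>
    (hb.contDiffAt (Ioi_mem_nhds hr)).differentiableAt (by norm_num)
  have hr0 : 0 < x 1 := hx.1
  have hr : x 1 ≠ 0 := hr0.ne'
  have hs : Real.sin (x 2) ≠ 0 := (Real.sin_pos_of_mem_Ioo hx.2).ne'
  have hbx := hb0 _ hr0
  have dda : DifferentiableAt ℝ (deriv a) (x 1) :=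
    ((ha.deriv_of_isOpen (m := 1) isOpen_Ioi (by norm_num)).contDiffAt
      (Ioi_mem_nhds hr0)).differentiableAt (by norm_num)
  have ddb : DifferentiableAt ℝ (deriv b) (x 1) :=
    ((hb.deriv_of_isOpen (m := 1) isOpen_Ioi (by norm_num)).contDiffAt
      (Ioi_mem_nhds hr0)).differentiableAt (by norm_num)
  have dax := (da _ hr0).hasDerivAt
  have dbx := (db _ hr0).hasDerivAt
  have dP : HasDerivAt (redshift a b) (deriv (redshift a b) (x 1)) (x 1) :=
    DifferentiableAt.hasDerivAt
      (((dda.mul (db _ hr0)).div_const 2).add ((da _ hr0).mul ddb))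
  have e1 := (((dax.fun_mul dbx).fun_mul dP)).deriv
  have e2 : deriv (fun r => a r * r) (x 1) = deriv a (x 1) * x 1 + a (x 1) := by
    simpa using (dax.fun_mul (hasDerivAt_id' (x 1))).deriv
  have e3 : deriv (fun θ => Real.sin θ * Real.cos θ) (x 2) =
      Real.cos (x 2) * Real.cos (x 2) - Real.sin (x 2) * Real.sin (x 2) := by
    refine ((Real.hasDerivAt_sin (x 2)).fun_mul (Real.hasDerivAt_cos (x 2))).deriv.trans ?_
    ring
  have e4 : deriv (fun θ => Real.cos θ / Real.sin θ) (x 2) = -1 - Real.cos (x 2) ^ 2 /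
      Real.sin (x 2) ^ 2 := by
    refine ((Real.hasDerivAt_cos (x 2)).fun_div (Real.hasDerivAt_sin (x 2)) hs).deriv.trans ?_
    field_simp
  have hpd : ∀ l i j k, pd l (christoffel (staticMetric a b) i j k) x = _ := fun l i j k =>
    pd_eq_of_eqOn (F := staticChristoffel a b i j k) (fun y hy =>
      christoffel_static hy (da _ hy.1) (db _ hy.1) (hb0 _ hy.1) i j k) hx l
  have hch := christoffel_static hx (da _ hr0) (db _ hr0) hbx
  have hsc : Real.cos (x 2) ^ 2 = 1 - Real.sin (x 2) ^ 2 := by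
    linarith [Real.sin_sq_add_cos_sq (x 2)]
  unfold ricci
  simp only [hpd, hch]
  fin_cases j <;> fin_cases k <;>
    simp [Fin.sum_univ_four, staticChristoffel, e1, e2, e3, e4]
  · simp only [redshift]
    field_simp
    ring
  · field_simp
    ring
  · field_simp
    ring
  · field_simp
    ring
  · field_simp
    ring
  · field_simp
    ring
  · field_simp
    rw [hsc]
    ring

theorem scalarCurvature_static {a b : ℝ → ℝ} (ha : ContDiffOn ℝ 2 a (Ioi 0))
    (hb : ContDiffOn ℝ 2 b (Ioi 0)) (hb0 : ∀ r, 0 < r → b r ≠ 0) {x : Fin 4 → ℝ}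
    (hx : x ∈ chartDomain) :
    scalarCurvature (staticMetric a b) x =
      -2 * (deriv (redshift a b) (x 1) + 2 * redshift a b (x 1) / x 1) / b (x 1) +
        a (x 1) * (2 * deriv b (x 1) / (b (x 1) * x 1)) +
        2 * (1 - a (x 1) - x 1 * deriv a (x 1) - a (x 1) * x 1 * deriv b (x 1) / b (x 1)) /
          x 1 ^ 2 := by
  have hr : x 1 ≠ 0 := hx.1.ne'
  have hs : Real.sin (x 2) ≠ 0 := (Real.sin_pos_of_mem_Ioo hx.2).ne'
  have hbx := hb0 _ hx.1
  unfold scalarCurvature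
  simp only [staticMetric_inv hx hbx, ricci_static ha hb hb0 hx]
  simp [Fin.sum_univ_four, staticInv]
  field_simp
  ring

/-! ### Reduction of the static Einstein–Euler equations to a first order system. -/

/-- The field equations of a static fluid configuration as a first order system for the metric
coefficients `a`, `b` and the density `ρ`. -/
structure IsStaticFluid (k ρ₀ : ℝ) (a b ρ : ℝ → ℝ) : Prop where
  cont_a : ContinuousOn a (Ici 0)
  cont_b : ContinuousOn b (Ici 0)
  cont_ρ : ContinuousOn ρ (Ici 0)
  a_zero : a 0 = 1
  b_zero : b 0 = 1
  ρ_zero : ρ 0 = ρ₀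
  a_pos : ∀ r, 0 ≤ r → 0 < a r
  b_pos : ∀ r, 0 ≤ r → 0 < b r
  ρ_pos : ∀ r, 0 ≤ r → 0 < ρ r
  deriv_a : ∀ r, 0 < r → HasDerivAt a ((1 - a r) / r - 8 * Real.pi * r * ρ r) r
  deriv_b : ∀ r, 0 < r → HasDerivAt b (4 * Real.pi * (1 + k ^ 2) * r * ρ r / a r * b r) r
  deriv_ρ : ∀ r, 0 < r → HasDerivAt ρ (-((1 + k ^ 2) / k ^ 2 * (ρ r / a r) *
    ((1 - a r) / (2 * r) + 4 * Real.pi * k ^ 2 * r * ρ r))) r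

namespace StaticSolution

variable {k ρ₀ : ℝ} (S : StaticSolution k ρ₀)

theorem field_equations {r : ℝ} (hr : 0 < r) :
    0 < S.u0 r ∧
    -(S.a r) * S.b r ^ 2 * S.u0 r ^ 2 + 2 * S.b r * S.u0 r * S.u1 r = -1 ∧
    (1 + k ^ 2) * S.ρ r * S.u1 r * (-(S.a r) * S.b r * S.u0 r + S.u1 r) = 0 ∧
    deriv S.b r / (S.b r * r) = 4 * Real.pi * (1 + k ^ 2) * S.ρ r * (S.b r * S.u0 r) ^ 2 ∧
    -(S.a r * deriv S.b r / r) - S.b r * (1 - S.a r - r * deriv S.a r -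
        S.a r * r * deriv S.b r / S.b r) / r ^ 2 =
      8 * Real.pi * ((1 + k ^ 2) * S.ρ r * (-(S.a r) * S.b r ^ 2 * S.u0 r + S.b r * S.u1 r) *
        (S.b r * S.u0 r) + k ^ 2 * S.ρ r * S.b r) ∧
    (deriv (redshift S.a S.b) r + 2 * redshift S.a S.b r / r) / S.b r -
        S.a r * deriv S.b r / (S.b r * r) = 8 * Real.pi * k ^ 2 * S.ρ r := by
  -- By symmetry one point per radius suffices; on the equator sin θ = 1.
  have hx : (![0, r, Real.pi / 2, 0] : Fin 4 → ℝ) ∈ chartDomain := by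
    simp [chartDomain, hr, Real.pi_pos]
  have hb0 : ∀ r, 0 < r → S.b r ≠ 0 := fun r hr => (S.b_pos r hr.le).ne'
  have hbr := hb0 r hr
  have hr0 := hr.ne'
  obtain ⟨h1, h2, h3⟩ := S.solves _ hx.1 hx.2
  have hG := fun i j => (show einsteinTensor (staticMetric S.a S.b) i j _ = _ from h3 i j)
  unfold einsteinTensor at hG
  simp only [scalarCurvature_static S.contDiff_a S.contDiff_b hb0 hx,
    ricci_static S.contDiff_a S.contDiff_b hb0 hx, fluidTensor] at hG
  have h00 := hG 0 0
  have h01 := hG 0 1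
  have h11 := hG 1 1
  have h22 := hG 2 2
  clear hG h3
  simp [efMetric, Matrix.mulVec, dotProduct, Fin.sum_univ_four] at h00 h01 h11 h22 h1 h2
  generalize redshift S.a S.b r = P at *
  generalize deriv (redshift S.a S.b) r = P' at *
  generalize deriv S.a r = a' at *
  generalize deriv S.b r = b' at *
  have hpi := Real.pi_pos
  refine ⟨h1, by linear_combination h2, ?_, ?_, ?_, ?_⟩
  -- In the combination of components 00 + a b · 01 both the curvature and the metric terms cancel,
  -- so only the velocity term of the fluid tensor is left.
  · have e := congrArg₂ (· + ·) h00 (congrArg (S.a r * S.b r * ·) h01)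
    have e2 : 8 * Real.pi * (S.b r * r ^ 2) * ((1 + k ^ 2) * S.ρ r * S.u1 r *
        (-(S.a r) * S.b r * S.u0 r + S.u1 r)) = 0 := by
      field_simp at e
      linear_combination -e
    have : 8 * Real.pi * (S.b r * r ^ 2) ≠ 0 := by
      have := S.b_pos r hr.le
      positivity
    exact (mul_eq_zero.mp e2).resolve_left this
  · linear_combination (1 / 2) * h11
  · rw [← sub_eq_zero] at h01 ⊢
    rw [← h01]
    field_simp
    ring
  · rw [← sub_eq_zero] at h22 ⊢
    have e2 : r ^ 2 * ((P' + 2 * P / r) / S.b r - S.a r * b' / (S.b r * r) -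
        8 * Real.pi * k ^ 2 * S.ρ r) = 0 := by
      rw [← h22]
      field_simp
      ring
    exact (mul_eq_zero.mp e2).resolve_left (by positivity)

/-- Since a(0) = 1, a nonpositive value would produce a zero of a. There the flux equation forces
`u1 = 0`, and the normalization of the velocity becomes 0 = -1. -/
theorem a_pos {r : ℝ} (hr : 0 ≤ r) : 0 < S.a r := by
  by_contra! hneg
  have hsub : Icc 0 r ⊆ Ici (0 : ℝ) := fun s hs => hs.1
  obtain ⟨s, hs, hs0⟩ := intermediate_value_Icc' hr (S.cont_a.mono hsub)
    ⟨hneg, by rw [S.a_zero]; exact zero_le_one⟩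
  have hspos : 0 < s := by
    rcases hs.1.eq_or_lt with h | h
    · rw [← h, S.a_zero] at hs0
      exact absurd hs0 one_ne_zero
    · exact h
  obtain ⟨-, hn, hu, -⟩ := S.field_equations hspos
  rw [hs0] at hn hu
  have hρ := S.ρ_pos s hs.1
  have hu1 : S.u1 s ^ 2 = 0 := by
    have hc : (1 + k ^ 2) * S.ρ s ≠ 0 := by positivity
    refine (mul_eq_zero.mp (?_ : (1 + k ^ 2) * S.ρ s * S.u1 s ^ 2 = 0)).resolve_left hc
    linear_combination hu
  rw [pow_eq_zero_iff two_ne_zero] at hu1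
  rw [hu1] at hn
  norm_num at hn

/-- The other root of the flux equation, u¹ = a b u⁰, would give the velocity the norm a (b u⁰)² ≥
0, so it would not be timelike. -/
theorem u1_eq_zero {r : ℝ} (hr : 0 < r) : S.u1 r = 0 := by
  obtain ⟨-, hn, hu, -⟩ := S.field_equations hr
  have hρ := S.ρ_pos r hr.le
  have hc : (1 + k ^ 2) * S.ρ r ≠ 0 := by positivity
  rcases mul_eq_zero.mp hu with h | h
  · exact (mul_eq_zero.mp h).resolve_left hc
  · exfalso
    have hu1 : S.u1 r = S.a r * S.b r * S.u0 r := by linear_combination h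
    rw [hu1] at hn
    have : 0 ≤ S.a r * (S.b r * S.u0 r) ^ 2 := mul_nonneg (S.a_pos hr.le).le (sq_nonneg _)
    nlinarith

theorem lapse_mul_sq {r : ℝ} (hr : 0 < r) : S.a r * (S.b r * S.u0 r) ^ 2 = 1 := by
  obtain ⟨-, hn, -⟩ := S.field_equations hr
  rw [S.u1_eq_zero hr] at hn
  linear_combination -hn

theorem data_M {r : ℝ} (hr : 0 < r) : S.data.M r = S.ρ r / S.a r := by
  have := S.lapse_mul_sq hr
  have ha := (S.a_pos hr.le).ne'
  rw [eq_div_iff ha]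
  simp only [data]
  linear_combination S.ρ r * this

theorem data_V {r : ℝ} (hr : 0 < r) : S.data.V r = -(S.a r / 2) := by
  simp [data, S.u1_eq_zero hr]

theorem differentiableAt_a {r : ℝ} (hr : 0 < r) : DifferentiableAt ℝ S.a r :=
  (S.contDiff_a.contDiffAt (Ioi_mem_nhds hr)).differentiableAt (by norm_num)

theorem differentiableAt_b {r : ℝ} (hr : 0 < r) : DifferentiableAt ℝ S.b r :=
  (S.contDiff_b.contDiffAt (Ioi_mem_nhds hr)).differentiableAt (by norm_num)

theorem deriv_b_eq {r : ℝ} (hr : 0 < r) :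
    deriv S.b r = 4 * Real.pi * (1 + k ^ 2) * r * S.ρ r / S.a r * S.b r := by
  obtain ⟨-, -, -, h, -⟩ := S.field_equations hr
  have ha := (S.a_pos hr.le).ne'
  have hb := (S.b_pos r hr.le).ne'
  have hM : (S.b r * S.u0 r) ^ 2 = 1 / S.a r := by
    rw [eq_div_iff ha, mul_comm]
    exact S.lapse_mul_sq hr
  rw [hM, div_eq_iff (mul_ne_zero hb hr.ne')] at h
  rw [h]
  field_simp

theorem deriv_a_eq {r : ℝ} (hr : 0 < r) :
    deriv S.a r = (1 - S.a r) / r - 8 * Real.pi * r * S.ρ r := by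
  obtain ⟨-, -, -, -, h, -⟩ := S.field_equations hr
  have ha := (S.a_pos hr.le).ne'
  have hb := (S.b_pos r hr.le).ne'
  have hr0 := hr.ne'
  rw [S.u1_eq_zero hr] at h
  have e : S.b r * (r * deriv S.a r - (1 - S.a r - 8 * Real.pi * r ^ 2 * S.ρ r)) = 0 := by
    field_simp at h
    linear_combination h -
      8 * Real.pi * (1 + k ^ 2) * r ^ 2 * S.ρ r * S.b r * S.lapse_mul_sq hr
  have e' := (mul_eq_zero.mp e).resolve_left hb
  field_simp
  linear_combination e'

/-- The density is only assumed continuous; solving the equation for a' lets it inherit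
differentiability from a ∈ C². -/
theorem ρ_eqOn : EqOn S.ρ (fun r => ((1 - S.a r) / r - deriv S.a r) / (8 * Real.pi * r))
    (Ioi 0) := by
  intro r hr
  have hr0 : r ≠ 0 := ne_of_gt hr
  have hpi := Real.pi_pos.ne'
  simp only [S.deriv_a_eq hr]
  field_simp
  ring

theorem differentiableAt_ρ {r : ℝ} (hr : 0 < r) : DifferentiableAt ℝ S.ρ r := by
  refine DifferentiableAt.congr_of_eventuallyEq ?_
    (S.ρ_eqOn.eventuallyEq_of_mem (Ioi_mem_nhds hr))
  have hr0 := hr.ne'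
  have hpi := Real.pi_pos
  have h1 := S.differentiableAt_a hr
  have h2 : DifferentiableAt ℝ (deriv S.a) r :=
    ((S.contDiff_a.deriv_of_isOpen (m := 1) isOpen_Ioi (by norm_num)).contDiffAt
      (Ioi_mem_nhds hr)).differentiableAt (by norm_num)
  have h3 : 8 * Real.pi * r ≠ 0 := by positivity
  fun_prop (disch := assumption)

theorem redshift_eqOn : EqOn (redshift S.a S.b)
    (fun r => S.b r * ((1 - S.a r) / (2 * r) + 4 * Real.pi * k ^ 2 * r * S.ρ r)) (Ioi 0) := by
  intro r hr
  have hr0 : r ≠ 0 := ne_of_gt hr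
  have ha := (S.a_pos (le_of_lt hr)).ne'
  simp only [redshift, S.deriv_a_eq hr, S.deriv_b_eq hr]
  field_simp
  ring

/-- The Tolman-Oppenheimer-Volkoff equation. -/
theorem deriv_ρ_eq (hk : k ≠ 0) {r : ℝ} (hr : 0 < r) :
    deriv S.ρ r = -((1 + k ^ 2) / k ^ 2 * (S.ρ r / S.a r) *
      ((1 - S.a r) / (2 * r) + 4 * Real.pi * k ^ 2 * r * S.ρ r)) := by
  obtain ⟨-, -, -, -, -, h⟩ := S.field_equations hr
  have ha := (S.a_pos hr.le).ne'
  have hb := (S.b_pos r hr.le).ne'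
  have hr0 := hr.ne'
  have hpi := Real.pi_pos.ne'
  have da := (S.differentiableAt_a hr).hasDerivAt
  have db := (S.differentiableAt_b hr).hasDerivAt
  have dρ := (S.differentiableAt_ρ hr).hasDerivAt
  have h2r : HasDerivAt (fun r : ℝ => 2 * r) 2 r := by
    simpa using (hasDerivAt_id r).const_mul 2
  have hc : HasDerivAt (fun r : ℝ => 4 * Real.pi * k ^ 2 * r) (4 * Real.pi * k ^ 2) r := by
    simpa using (hasDerivAt_id r).const_mul (4 * Real.pi * k ^ 2)
  have dF := ((da.const_sub 1).fun_div h2r (by positivity)).fun_add (hc.fun_mul dρ)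
  -- The angular equation contains the derivative of the redshift coefficient; once that coefficient
  -- is expressed through a, b, ρ, the only unknown left is ρ'.
  have dP := (S.redshift_eqOn.eventuallyEq_of_mem (Ioi_mem_nhds hr)).deriv_eq.trans
    (db.fun_mul dF).deriv
  rw [dP, S.redshift_eqOn hr, S.deriv_b_eq hr, S.deriv_a_eq hr] at h
  generalize deriv S.ρ r = ρ' at *
  field_simp at h ⊢
  refine mul_left_cancel₀ (by positivity : 4 * Real.pi * r ^ 2 ≠ 0) ?_
  linear_combination h

theorem isStaticFluid (hk : k ≠ 0) : IsStaticFluid k ρ₀ S.a S.b S.ρ where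
  cont_a := S.cont_a
  cont_b := S.cont_b
  cont_ρ := S.cont_ρ
  a_zero := S.a_zero
  b_zero := S.b_zero
  ρ_zero := S.ρ_zero
  a_pos _ := S.a_pos
  b_pos := S.b_pos
  ρ_pos := S.ρ_pos
  deriv_a _ hr := S.deriv_a_eq hr ▸ (S.differentiableAt_a hr).hasDerivAt
  deriv_b _ hr := S.deriv_b_eq hr ▸ (S.differentiableAt_b hr).hasDerivAt
  deriv_ρ _ hr := S.deriv_ρ_eq hk hr ▸ (S.differentiableAt_ρ hr).hasDerivAt

end StaticSolution

/-! ### A barrier principle. -/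

/-- A function on `[0, ∞)` that is nonincreasing wherever it exceeds a bound for its initial value
never exceeds this bound. -/
theorem le_of_deriv_nonpos_of_lt {f f' : ℝ → ℝ} {c : ℝ} (hf : ContinuousOn f (Ici 0))
    (h0 : f 0 ≤ c) (hd : ∀ r, 0 < r → HasDerivAt f (f' r) r)
    (hneg : ∀ r, 0 < r → c < f r → f' r ≤ 0) {r : ℝ} (hr : 0 ≤ r) : f r ≤ c := by
  by_contra! hlt
  set A := Icc 0 r ∩ f ⁻¹' Iic c
  have hA : IsClosed A := (hf.mono fun s hs => hs.1).preimage_isClosed_of_isClosed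
    isClosed_Icc isClosed_Iic
  have hAne : A.Nonempty := ⟨0, ⟨le_rfl, hr⟩, h0⟩
  have hAb : BddAbove A := ⟨r, fun s hs => hs.1.2⟩
  obtain ⟨⟨hs0, hsr⟩, hsc⟩ := hA.csSup_mem hAne hAb
  -- The last point up to r where f ≤ c: f exceeds c strictly between s and r, hence is antitone
  -- there, against f s ≤ c < f r.
  set s := sSup A
  have hgt : ∀ t ∈ Ioo s r, c < f t := by
    intro t ht
    by_contra! hle
    exact absurd (le_csSup hAb ⟨⟨hs0.trans ht.1.le, ht.2.le⟩, hle⟩) (not_le.mpr ht.1)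
  have hanti : AntitoneOn f (Icc s r) := by
    refine antitoneOn_of_deriv_nonpos (convex_Icc s r) (hf.mono fun t ht => hs0.trans ht.1) ?_ ?_
    · intro t ht
      rw [interior_Icc] at ht
      exact (hd t (hs0.trans_lt ht.1)).differentiableAt.differentiableWithinAt
    · intro t ht
      rw [interior_Icc] at ht
      have htpos := hs0.trans_lt ht.1
      rw [(hd t htpos).deriv]
      exact hneg t htpos (hgt t ht)
  exact absurd ((hanti ⟨le_rfl, hsr⟩ ⟨hsr, le_rfl⟩ hsr).trans hsc) (not_le.mpr hlt)

/-! ### A priori bounds for static fluids, uniform in the solution. -/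

namespace IsStaticFluid

variable {k ρ₀ : ℝ} {a b ρ : ℝ → ℝ}

theorem continuousOn_id_mul_one_sub (F : IsStaticFluid k ρ₀ a b ρ) :
    ContinuousOn (fun r => r * (1 - a r)) (Ici 0) :=
  continuousOn_id.mul (continuousOn_const.sub F.cont_a)

theorem hasDerivAt_mass (F : IsStaticFluid k ρ₀ a b ρ) {r : ℝ} (hr : 0 < r) :
    HasDerivAt (fun r => r * (1 - a r)) (8 * Real.pi * r ^ 2 * ρ r) r := by
  refine ((hasDerivAt_id' r).fun_mul ((F.deriv_a r hr).const_sub 1)).congr_deriv ?_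
  field_simp
  ring

theorem a_le_one (F : IsStaticFluid k ρ₀ a b ρ) {r : ℝ} (hr : 0 ≤ r) : a r ≤ 1 := by
  rcases hr.eq_or_lt with rfl | hr'
  · exact F.a_zero.le
  have h := le_of_deriv_nonpos_of_lt (f := fun r => -(r * (1 - a r))) (c := 0)
    F.continuousOn_id_mul_one_sub.neg (by simp) (fun s hs => (F.hasDerivAt_mass hs).fun_neg)
    (fun s hs _ => by
      have := F.ρ_pos s hs.le
      have : 0 ≤ 8 * Real.pi * s ^ 2 * ρ s := by positivity
      linarith) hr
  by_contra! h1
  nlinarith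

theorem deriv_ρ' (F : IsStaticFluid k ρ₀ a b ρ) (hk : 0 < k) {r : ℝ} (hr : 0 < r) :
    HasDerivAt ρ (-((1 + k ^ 2) / (2 * k ^ 2) * (ρ r / (r * a r)) *
      (1 - a r + 8 * Real.pi * k ^ 2 * r ^ 2 * ρ r))) r := by
  have := (F.a_pos r hr.le).ne'
  refine (F.deriv_ρ r hr).congr_deriv ?_
  field_simp
  ring

theorem deriv_ρ_nonpos (F : IsStaticFluid k ρ₀ a b ρ) {r : ℝ} (hr : 0 < r) :
    -((1 + k ^ 2) / k ^ 2 * (ρ r / a r) *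
      ((1 - a r) / (2 * r) + 4 * Real.pi * k ^ 2 * r * ρ r)) ≤ 0 := by
  have h1 := F.a_pos r hr.le
  have h2 := F.ρ_pos r hr.le
  have h3 : 0 ≤ 1 - a r := sub_nonneg.mpr (F.a_le_one hr.le)
  have : 0 ≤ (1 + k ^ 2) / k ^ 2 * (ρ r / a r) *
      ((1 - a r) / (2 * r) + 4 * Real.pi * k ^ 2 * r * ρ r) := by positivity
  linarith

theorem ρ_le (F : IsStaticFluid k ρ₀ a b ρ) {r : ℝ} (hr : 0 ≤ r) : ρ r ≤ ρ₀ :=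
  le_of_deriv_nonpos_of_lt F.cont_ρ F.ρ_zero.le F.deriv_ρ (fun _ hs _ => F.deriv_ρ_nonpos hs) hr

/-- The mean density is at least the density, since the density is nonincreasing. -/
theorem density_le_one_sub (F : IsStaticFluid k ρ₀ a b ρ) {r : ℝ} (hr : 0 < r) :
    8 * Real.pi / 3 * r ^ 2 * ρ r ≤ 1 - a r := by
  have h := le_of_deriv_nonpos_of_lt
    (f := fun r => 8 * Real.pi / 3 * r ^ 3 * ρ r - r * (1 - a r)) (c := 0)
    (((continuousOn_const.mul (continuousOn_id.pow 3)).mul F.cont_ρ).sub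
      F.continuousOn_id_mul_one_sub) (by simp)
    (fun s hs => ((((hasDerivAt_id' s).fun_pow 3).const_mul (8 * Real.pi / 3)).fun_mul
      (F.deriv_ρ s hs)).fun_sub (F.hasDerivAt_mass hs))
    (fun s hs _ => by
      have h1 := F.deriv_ρ_nonpos hs
      have h2 : 0 ≤ 8 * Real.pi / 3 * s ^ 3 := by positivity
      have h3 := mul_nonpos_of_nonneg_of_nonpos h2 h1
      have h4 : 8 * Real.pi / 3 * (((3 : ℕ) : ℝ) * s ^ (3 - 1) * 1) * ρ s =
        8 * Real.pi * s ^ 2 * ρ s := by push_cast; ring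
      rw [h4]
      linarith) hr.le
  refine le_of_mul_le_mul_left ?_ hr
  linarith

theorem one_sub_le (F : IsStaticFluid k ρ₀ a b ρ) {r : ℝ} (hr : 0 < r) :
    1 - a r ≤ 8 * Real.pi / 3 * ρ₀ * r ^ 2 := by
  have h := le_of_deriv_nonpos_of_lt
    (f := fun r => r * (1 - a r) - 8 * Real.pi / 3 * ρ₀ * r ^ 3) (c := 0)
    (F.continuousOn_id_mul_one_sub.sub (continuousOn_const.mul (continuousOn_id.pow 3))) (by simp)
    (fun s hs => (F.hasDerivAt_mass hs).fun_sub
      (((hasDerivAt_id' s).fun_pow 3).const_mul (8 * Real.pi / 3 * ρ₀)))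
    (fun s hs _ => by
      have h1 := F.ρ_le hs.le
      have h2 : 0 ≤ 8 * Real.pi * s ^ 2 := by positivity
      have h3 := mul_le_mul_of_nonneg_left h1 h2
      norm_num
      linarith) hr.le
  refine le_of_mul_le_mul_left ?_ hr
  linarith

/-- The derivative of `4 π r² ρ`. -/
theorem hasDerivAt_density (F : IsStaticFluid k ρ₀ a b ρ) (hk : 0 < k) {r : ℝ} (hr : 0 < r) :
    HasDerivAt (fun r => 4 * Real.pi * r ^ 2 * ρ r)
      (4 * Real.pi * r ^ 2 * ρ r / (r * a r) * (2 * a r - (1 + k ^ 2) / (2 * k ^ 2) *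
        (1 - a r + 2 * k ^ 2 * (4 * Real.pi * r ^ 2 * ρ r)))) r := by
  have := (F.a_pos r hr.le).ne'
  refine ((((hasDerivAt_id' r).fun_pow 2).const_mul (4 * Real.pi)).fun_mul
    (F.deriv_ρ' hk hr)).congr_deriv ?_
  norm_num
  field_simp
  ring

theorem continuousOn_density (F : IsStaticFluid k ρ₀ a b ρ) :
    ContinuousOn (fun r => 4 * Real.pi * r ^ 2 * ρ r) (Ici 0) :=
  (continuousOn_const.mul (continuousOn_id.pow 2)).mul F.cont_ρ

/-- The a priori bounds use k < 1 through this inequality. -/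
theorem one_le_coeff (hk : 0 < k) (hk1 : k < 1) : 1 ≤ (1 + k ^ 2) / (2 * k ^ 2) := by
  rw [le_div_iff₀ (by positivity)]
  nlinarith

theorem coeff_mul (hk : 0 < k) (x y : ℝ) : (1 + k ^ 2) / (2 * k ^ 2) * (x + 2 * k ^ 2 * y) =
    (1 + k ^ 2) / (2 * k ^ 2) * x + (1 + k ^ 2) * y := by
  field_simp

/-- With y = 4πr²ρ, the sign of y' is governed by a factor at most 2 - 3(1 - a) - y. As 1 - a ≥
2y/3, this is at most 2 - 3y, which is negative above the threshold 2/3. -/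
theorem density_le (F : IsStaticFluid k ρ₀ a b ρ) (hk : 0 < k) (hk1 : k < 1) {r : ℝ}
    (hr : 0 ≤ r) : 4 * Real.pi * r ^ 2 * ρ r ≤ 2 / 3 := by
  refine le_of_deriv_nonpos_of_lt F.continuousOn_density (by norm_num)
    (fun s hs => F.hasDerivAt_density hk hs) (fun s hs hlt => ?_) hr
  have h1 := F.a_pos s hs.le
  have h2 := F.ρ_pos s hs.le
  have h3 := F.density_le_one_sub hs
  refine mul_nonpos_of_nonneg_of_nonpos (by positivity) ?_
  rw [coeff_mul hk]
  have hα := one_le_coeff hk hk1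
  set y := 4 * Real.pi * s ^ 2 * ρ s
  have h3' : 2 / 3 * y ≤ 1 - a s := by simp only [y]; linarith
  have h4 : 1 - a s ≤ (1 + k ^ 2) / (2 * k ^ 2) * (1 - a s) :=
    le_mul_of_one_le_left (by linarith) hα
  have h5 : y ≤ (1 + k ^ 2) * y := le_mul_of_one_le_left (by linarith) (by nlinarith)
  linarith

/-- For y = 4πr²ρ, the terms in y cancel in the upper bound for the derivative of y²/a, leaving the
factor 4 - 7(1 - a), nonpositive once a ≤ 3/7. The constant is 28/27 = (2/3)²/(3/7), so y²/a > 28/27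
together with y ≤ 2/3 forces a < 3/7. -/
theorem density_sq_le (F : IsStaticFluid k ρ₀ a b ρ) (hk : 0 < k) (hk1 : k < 1) {r : ℝ}
    (hr : 0 ≤ r) : (4 * Real.pi * r ^ 2 * ρ r) ^ 2 ≤ 28 / 27 * a r := by
  rw [← div_le_iff₀ (F.a_pos r hr)]
  refine le_of_deriv_nonpos_of_lt
    (f := fun r => (4 * Real.pi * r ^ 2 * ρ r) ^ 2 / a r)
    ((F.continuousOn_density.pow 2).div F.cont_a fun s hs => (F.a_pos s hs).ne') (by norm_num)
    (fun s hs => ((F.hasDerivAt_density hk hs).fun_pow 2).fun_div (F.deriv_a s hs)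
      (F.a_pos s hs.le).ne') (fun s hs hlt => ?_) hr
  have h1 := F.a_pos s hs.le
  have h2 := F.ρ_pos s hs.le
  have h3 := F.density_le hk hk1 hs.le
  have hα := one_le_coeff hk hk1
  rw [lt_div_iff₀ h1] at hlt
  have e : (1 - a s) / s - 8 * Real.pi * s * ρ s =
      (1 - a s - 2 * (4 * Real.pi * s ^ 2 * ρ s)) / s := by
    field_simp
    ring
  rw [coeff_mul hk, e]
  have hy : 0 < 4 * Real.pi * s ^ 2 * ρ s := by positivity
  generalize 4 * Real.pi * s ^ 2 * ρ s = y at *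
  have h4 : 4 / 7 ≤ 1 - a s := by nlinarith
  have h5 : 1 - a s ≤ (1 + k ^ 2) / (2 * k ^ 2) * (1 - a s) :=
    le_mul_of_one_le_left (by linarith) hα
  have h6 : y ≤ (1 + k ^ 2) * y := le_mul_of_one_le_left hy.le (by nlinarith)
  generalize (1 + k ^ 2) / (2 * k ^ 2) * (1 - a s) = z at *
  generalize (1 + k ^ 2) * y = w at *
  refine div_nonpos_of_nonpos_of_nonneg ?_ (by positivity)
  have : ((2 : ℕ) : ℝ) * y ^ (2 - 1) * (y / (s * a s) * (2 * a s - (z + w))) * a s -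
      y ^ 2 * ((1 - a s - 2 * y) / s) =
      y ^ 2 / s * (4 * a s - 2 * z - 2 * w - (1 - a s - 2 * y)) := by
    norm_num
    field_simp
    ring
  rw [this]
  exact mul_nonpos_of_nonneg_of_nonpos (by positivity) (by linarith)

/-- A Buchdahl-type inequality: static solutions stay away from trapping. -/
theorem le_a (F : IsStaticFluid k ρ₀ a b ρ) (hk : 0 < k) (hk1 : k < 1) {r : ℝ}
    (hr : 0 ≤ r) : 1 / 8 ≤ a r := by
  have := le_of_deriv_nonpos_of_lt (c := -(1 / 8)) F.cont_a.neg
    (by simp only [Pi.neg_apply]; rw [F.a_zero]; norm_num)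
    (fun s hs => (F.deriv_a s hs).neg) (fun s hs hlt => ?_) hr
  · simpa using this
  have hlt' : a s < 1 / 8 := by simpa using hlt
  have h1 := F.density_sq_le hk hk1 hs.le
  have e : -((1 - a s) / s - 8 * Real.pi * s * ρ s) =
      -(1 - a s - 2 * (4 * Real.pi * s ^ 2 * ρ s)) / s := by
    field_simp
    ring
  rw [e]
  generalize 4 * Real.pi * s ^ 2 * ρ s = y at *
  refine div_nonpos_of_nonpos_of_nonneg ?_ hs.le
  -- Where a < 1/8, y² ≤ (28/27)a makes y small enough that 1 - a - 2y ≥ 0, so a cannot decrease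
  -- there.
  nlinarith

theorem one_le_b (F : IsStaticFluid k ρ₀ a b ρ) {r : ℝ} (hr : 0 ≤ r) : 1 ≤ b r := by
  have := le_of_deriv_nonpos_of_lt (c := -1) F.cont_b.neg (by simp [F.b_zero])
    (fun s hs => (F.deriv_b s hs).neg) (fun s hs _ => ?_) hr
  · simpa using this
  have h1 := F.a_pos s hs.le
  have h2 := F.ρ_pos s hs.le
  have h3 := F.b_pos s hs.le
  exact neg_nonpos.mpr (by positivity)

/-- Hydrostatic equilibrium says ρ'/ρ = -α (ab²)'/(ab²) with α = (1 + k²)/(2k²). Since α ≥ 1 and ab²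
is nondecreasing, ρ a b² is nonincreasing. -/
theorem ρ_mul_lapse_le (F : IsStaticFluid k ρ₀ a b ρ) (hk : 0 < k) (hk1 : k < 1) {r : ℝ}
    (hr : 0 ≤ r) : ρ r * (a r * b r ^ 2) ≤ ρ₀ := by
  refine le_of_deriv_nonpos_of_lt (f := fun r => ρ r * (a r * b r ^ 2))
    (F.cont_ρ.mul (F.cont_a.mul (F.cont_b.pow 2))) (by simp [F.a_zero, F.b_zero, F.ρ_zero])
    (fun s hs => (F.deriv_ρ' hk hs).fun_mul ((F.deriv_a s hs).fun_mul ((F.deriv_b s hs).fun_pow 2)))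
    (fun s hs _ => ?_) hr
  have h1 := F.a_pos s hs.le
  have h2 := F.ρ_pos s hs.le
  have h3 := F.b_pos s hs.le
  have h4 := sub_nonneg.mpr (F.a_le_one hs.le)
  have hα := one_le_coeff hk hk1
  generalize (1 + k ^ 2) / (2 * k ^ 2) = α at *
  have hle : ρ s * b s ^ 2 / s * (1 - a s + 8 * Real.pi * k ^ 2 * s ^ 2 * ρ s) * (1 - α) ≤ 0 :=
    mul_nonpos_of_nonneg_of_nonpos (by positivity) (by linarith)
  refine (Eq.le ?_).trans hle
  norm_num
  field_simp
  ring

theorem ρ_mul_b_le (F : IsStaticFluid k ρ₀ a b ρ) (hk : 0 < k) (hk1 : k < 1) {r : ℝ}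
    (hr : 0 ≤ r) : b r * ρ r ≤ 8 * ρ₀ := by
  have h1 := F.ρ_mul_lapse_le hk hk1 hr
  have h2 := F.le_a hk hk1 hr
  have h3 := F.one_le_b hr
  have h4 := F.ρ_pos r hr
  have h5 : 1 / 8 * b r ≤ a r * b r ^ 2 := by
    have : b r ≤ b r ^ 2 := by nlinarith
    nlinarith
  nlinarith [mul_le_mul_of_nonneg_left h5 h4.le]

/-- Decay rate of a Gaussian lower bound for the density. -/
def decayRate (k ρ₀ : ℝ) : ℝ :=
  4 * ((1 + k ^ 2) / k ^ 2) * (4 * Real.pi / 3 * ρ₀ + 4 * Real.pi * k ^ 2 * ρ₀)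

/-- The bounds 1/a ≤ 8, 1 - a ≤ (8π/3)ρ₀r² and ρ ≤ ρ₀ show that the logarithmic derivative of ρ is
at least a negative multiple of r, so ρ times a growing Gaussian is nondecreasing. -/
theorem le_ρ (F : IsStaticFluid k ρ₀ a b ρ) (hk : 0 < k) (hk1 : k < 1) {r : ℝ}
    (hr : 0 ≤ r) : ρ₀ * Real.exp (-(decayRate k ρ₀ * r ^ 2)) ≤ ρ r := by
  have hd : ∀ s : ℝ, HasDerivAt (fun s => Real.exp (decayRate k ρ₀ * s ^ 2))
      (Real.exp (decayRate k ρ₀ * s ^ 2) * (decayRate k ρ₀ * (2 * s))) s := fun s => by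
    simpa using (((hasDerivAt_id' s).fun_pow 2).const_mul (decayRate k ρ₀)).exp
  have h := le_of_deriv_nonpos_of_lt
    (f := fun s => -(ρ s * Real.exp (decayRate k ρ₀ * s ^ 2))) (c := -ρ₀)
    (F.cont_ρ.mul fun s _ => (hd s).continuousAt.continuousWithinAt).neg (by simp [F.ρ_zero])
    (fun s hs => ((F.deriv_ρ s hs).fun_mul (hd s)).fun_neg) (fun s hs _ => ?_) hr
  · rw [Real.exp_neg, ← div_eq_mul_inv, div_le_iff₀ (Real.exp_pos _)]
    linarith
  have h1 := F.le_a hk hk1 hs.le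
  have h2 := F.ρ_pos s hs.le
  have h3 := F.ρ_le hs.le
  have h4 := F.one_sub_le hs
  have h6 := sub_nonneg.mpr (F.a_le_one hs.le)
  have h5 : (1 - a s) / (2 * s) + 4 * Real.pi * k ^ 2 * s * ρ s ≤
      (4 * Real.pi / 3 * ρ₀ + 4 * Real.pi * k ^ 2 * ρ₀) * s := by
    have e1 : (1 - a s) / (2 * s) ≤ 4 * Real.pi / 3 * ρ₀ * s := by
      rw [div_le_iff₀ (by positivity)]
      linarith
    have e2 : 4 * Real.pi * k ^ 2 * s * ρ s ≤ 4 * Real.pi * k ^ 2 * s * ρ₀ :=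
      mul_le_mul_of_nonneg_left h3 (by positivity)
    linarith
  have h7 : ρ s / a s ≤ 8 * ρ s := by
    rw [div_le_iff₀ (by linarith)]
    nlinarith
  have h8 : (1 + k ^ 2) / k ^ 2 * (ρ s / a s) *
      ((1 - a s) / (2 * s) + 4 * Real.pi * k ^ 2 * s * ρ s) ≤
      (1 + k ^ 2) / k ^ 2 * (8 * ρ s) *
        ((4 * Real.pi / 3 * ρ₀ + 4 * Real.pi * k ^ 2 * ρ₀) * s) := by
    have : 0 < a s := by linarith
    gcongr
  have h9 : (1 + k ^ 2) / k ^ 2 * (8 * ρ s) *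
        ((4 * Real.pi / 3 * ρ₀ + 4 * Real.pi * k ^ 2 * ρ₀) * s) =
      ρ s * (decayRate k ρ₀ * (2 * s)) := by
    unfold decayRate
    ring
  rw [h9] at h8
  nlinarith [mul_le_mul_of_nonneg_right h8 (Real.exp_pos (decayRate k ρ₀ * s ^ 2)).le]

end IsStaticFluid

/-! ### Effect of the velocity step on the coefficient a. -/

theorem intervalIntegral_indicator_Icc {l u r : ℝ} (hl : 0 < l) (hr : 0 ≤ r) (f : ℝ → ℝ) :
    ∫ s in (0 : ℝ)..r, (Icc l u).indicator f s = ∫ s in Icc l (min r u), f s := by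
  have hset : Ioc 0 r ∩ Icc l u = Icc l (min r u) := by
    ext s
    simp only [mem_inter_iff, mem_Ioc, mem_Icc, le_min_iff]
    constructor
    · rintro ⟨⟨-, h2⟩, h3, h4⟩
      exact ⟨h3, h2, h4⟩
    · rintro ⟨h1, h2, h3⟩
      exact ⟨⟨hl.trans_le h1, h2⟩, h1, h3⟩
  rw [intervalIntegral.integral_of_le hr, MeasureTheory.setIntegral_indicator measurableSet_Icc,
    hset]

namespace IsStaticFluid

variable {k ρ₀ : ℝ} {a b ρ : ℝ → ℝ}

theorem continuousOn_source (F : IsStaticFluid k ρ₀ a b ρ) :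
    ContinuousOn (fun s => b s * ρ s * s ^ 2) (Ici 0) :=
  (F.cont_b.mul F.cont_ρ).mul (continuousOn_id.pow 2)

theorem continuousOn_staticSource (F : IsStaticFluid k ρ₀ a b ρ) :
    ContinuousOn (fun s => b s * (ρ s / a s) * ((1 - k ^ 2) / (1 + k ^ 2) * a s + 1) * s ^ 2)
      (Ici 0) :=
  ((F.cont_b.mul (F.cont_ρ.div F.cont_a fun s hs => (F.a_pos s hs).ne')).mul
    ((continuousOn_const.mul F.cont_a).add continuousOn_const)).mul (continuousOn_id.pow 2)

/-- The integrand is, up to the constant, the derivative of r(1 - a)b. Thus the integral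
representation with 2|V| = a returns the static a. -/
theorem integral_staticSource (F : IsStaticFluid k ρ₀ a b ρ) {r : ℝ} (hr : 0 ≤ r) :
    ∫ s in (0 : ℝ)..r, b s * (ρ s / a s) * ((1 - k ^ 2) / (1 + k ^ 2) * a s + 1) * s ^ 2 =
      r * (1 - a r) * b r / (4 * Real.pi * (1 + k ^ 2)) := by
  have hpi := Real.pi_pos
  have hsub : uIcc 0 r ⊆ Ici (0 : ℝ) := by
    rw [uIcc_of_le hr]
    exact fun s hs => hs.1
  have h := intervalIntegral.integral_eq_sub_of_hasDerivAt_of_le hr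
    (f := fun s => s * (1 - a s) * b s / (4 * Real.pi * (1 + k ^ 2)))
    (f' := fun s => b s * (ρ s / a s) * ((1 - k ^ 2) / (1 + k ^ 2) * a s + 1) * s ^ 2)
    (((F.continuousOn_id_mul_one_sub.mul F.cont_b).div_const _).mono fun s hs => hs.1)
    (fun s hs => by
      have ha := (F.a_pos s hs.1.le).ne'
      refine (((F.hasDerivAt_mass hs.1).fun_mul (F.deriv_b s hs.1)).div_const _).congr_deriv ?_
      field_simp
      ring)
    (F.continuousOn_staticSource.mono hsub).intervalIntegrable
  simpa using h

end IsStaticFluid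

namespace StaticSolution

variable {k ρ₀ : ℝ} (S : StaticSolution k ρ₀)

theorem perturbed_V {rs δ h r : ℝ} (hr : 0 < r) :
    (S.data.perturbed k rs δ h).V r =
      -(S.a r / 2) * (1 + (Icc (rs - δ) (rs + δ)).indicator (fun _ => 1 / h) r) := by
  simp only [SliceData.perturbed, velocityStep, S.data_V hr, indicator, mem_Icc]
  by_cases h1 : r < rs - δ
  · simp [h1, not_le.mpr h1, -tsub_le_iff_right]
  · by_cases h2 : r ≤ rs + δ
    · simp [h1, h2, not_lt.mp h1]
      ring
    · simp [h1, h2]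

theorem perturbed_a_zero {rs δ h : ℝ} : (S.data.perturbed k rs δ h).a 0 = 1 := by
  simp [SliceData.perturbed, aIntegral]

theorem perturbed_a (hk : 0 < k) {rs δ h r : ℝ} (hδ : δ < rs) (hh : 0 < h)
    (hr : 0 < r) :
    (S.data.perturbed k rs δ h).a r = S.a r - 4 * Real.pi * (1 - k ^ 2) / (h * (r * S.b r)) *
      ∫ s in Icc (rs - δ) (min r (rs + δ)), S.b s * S.ρ s * s ^ 2 := by
  have F := S.isStaticFluid hk.ne'
  have hb := (S.b_pos r hr.le).ne'
  have hpi := Real.pi_pos.ne'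
  have hsub : uIcc 0 r ⊆ Ici (0 : ℝ) := by
    rw [uIcc_of_le hr.le]
    exact fun s hs => hs.1
  rw [← intervalIntegral_indicator_Icc (sub_pos.mpr hδ) hr.le]
  set χ : ℝ → ℝ := (Icc (rs - δ) (rs + δ)).indicator fun s => S.b s * S.ρ s * s ^ 2 with hχ
  have hint : IntervalIntegrable χ MeasureTheory.volume 0 r := by
    rw [intervalIntegrable_iff]
    exact ((F.continuousOn_source.mono hsub).intervalIntegrable.def').indicator measurableSet_Icc
  have hcongr : ∫ s in (0 : ℝ)..r, S.b s / S.b r * S.data.M s *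
      (2 * ((1 - k ^ 2) / (1 + k ^ 2)) * |(S.data.perturbed k rs δ h).V s| + 1) * s ^ 2 =
      ∫ s in (0 : ℝ)..r, ((1 / S.b r) *
        (S.b s * (S.ρ s / S.a s) * ((1 - k ^ 2) / (1 + k ^ 2) * S.a s + 1) * s ^ 2) +
        (1 - k ^ 2) / (1 + k ^ 2) / (h * S.b r) * χ s) := by
    -- This form of congruence only asks for s > 0: the velocity at the center is unconstrained, so
    -- the formulas for M and V are not available at s = 0.
    refine intervalIntegral.integral_congr_ae (Eventually.of_forall fun s hs => ?_)
    rw [uIoc_of_le hr.le] at hs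
    have ha := S.a_pos hs.1.le
    have ha' := ha.ne'
    have hi : 0 ≤ (Icc (rs - δ) (rs + δ)).indicator (fun _ => 1 / h) s :=
      indicator_nonneg (fun _ _ => by positivity) s
    rw [S.perturbed_V hs.1, S.data_M hs.1, abs_mul, abs_neg, abs_of_pos (half_pos ha),
      abs_of_nonneg (by linarith), hχ]
    by_cases hm : s ∈ Icc (rs - δ) (rs + δ)
    · simp only [indicator_of_mem hm]
      field_simp
      ring
    · simp only [indicator_of_notMem hm]
      field_simp
      ring
  have hmain : (S.data.perturbed k rs δ h).a r = 1 - 4 * Real.pi * (1 + k ^ 2) / r *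
      ∫ s in (0 : ℝ)..r, S.b s / S.b r * S.data.M s *
      (2 * ((1 - k ^ 2) / (1 + k ^ 2)) * |(S.data.perturbed k rs δ h).V s| + 1) * s ^ 2 := rfl
  rw [hmain, hcongr, intervalIntegral.integral_add
    (((F.continuousOn_staticSource.mono hsub).intervalIntegrable).const_mul _)
    (hint.const_mul _), intervalIntegral.integral_const_mul, intervalIntegral.integral_const_mul,
    F.integral_staticSource hr.le]
  field_simp
  ring

/-- The amount by which the perturbation lowers `r b a`, up to a constant factor. -/
abbrev massShift (rs δ r : ℝ) : ℝ :=
  ∫ s in Icc (rs - δ) (min r (rs + δ)), S.b s * S.ρ s * s ^ 2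

theorem massShift_eq_zero {rs δ r : ℝ} (hr : r < rs - δ) : S.massShift rs δ r = 0 := by
  rw [massShift, Icc_eq_empty (by rw [not_le]; exact (min_le_left _ _).trans_lt hr)]
  simp

theorem integrableOn_source (hk : 0 < k) {l u : ℝ} (hl : 0 ≤ l) :
    MeasureTheory.IntegrableOn (fun s => S.b s * S.ρ s * s ^ 2) (Icc l u) :=
  ((S.isStaticFluid hk.ne').continuousOn_source.mono fun _ hs =>
    hl.trans hs.1).integrableOn_compact isCompact_Icc

theorem source_nonneg {s : ℝ} (hs : 0 ≤ s) : 0 ≤ S.b s * S.ρ s * s ^ 2 := by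
  have := S.b_pos s hs
  have := S.ρ_pos s hs
  positivity

theorem massShift_nonneg {rs δ r : ℝ} (hδ : δ < rs) : 0 ≤ S.massShift rs δ r :=
  MeasureTheory.setIntegral_nonneg measurableSet_Icc fun _ hs =>
    S.source_nonneg ((sub_pos.mpr hδ).le.trans hs.1)

/-- On the step bρ ≤ 8ρ₀ and s ≤ 2`rs`, and the interval has length 2δ; hence 64 = 8 · 4 · 2. -/
theorem massShift_le (hk : 0 < k) (hk1 : k < 1) {rs δ r : ℝ} (hδ0 : 0 < δ) (hδ : δ < rs)
    (hρ₀ : 0 < ρ₀) : S.massShift rs δ r ≤ 64 * ρ₀ * rs ^ 2 * δ := by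
  have F := S.isStaticFluid hk.ne'
  have h0 := sub_pos.mpr hδ
  calc S.massShift rs δ r ≤ ∫ s in Icc (rs - δ) (rs + δ), S.b s * S.ρ s * s ^ 2 :=
        MeasureTheory.setIntegral_mono_set (S.integrableOn_source hk h0.le)
          ((MeasureTheory.ae_restrict_iff' measurableSet_Icc).mpr (Eventually.of_forall
            fun s hs => S.source_nonneg (h0.le.trans hs.1)))
          (Icc_subset_Icc_right (min_le_right _ _)).eventuallyLE
    _ ≤ ∫ _ in Icc (rs - δ) (rs + δ), 8 * ρ₀ * (2 * rs) ^ 2 := by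
        refine MeasureTheory.setIntegral_mono_on (S.integrableOn_source hk h0.le)
          (continuousOn_const.integrableOn_compact isCompact_Icc) measurableSet_Icc fun s hs => ?_
        have hs0 : 0 ≤ s := h0.le.trans hs.1
        have := F.ρ_mul_b_le hk hk1 hs0
        have hs2 : s ≤ 2 * rs := hs.2.trans (by linarith)
        gcongr
    _ = 64 * ρ₀ * rs ^ 2 * δ := by
        have : rs - δ ≤ rs + δ := by linarith
        rw [MeasureTheory.setIntegral_const, MeasureTheory.measureReal_def, Real.volume_Icc,
          ENNReal.toReal_ofReal (sub_nonneg.mpr this), smul_eq_mul]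
        ring

theorem le_massShift (hk : 0 < k) {rs δ r m : ℝ} (hδ : δ < rs)
    (hr : rs - δ ≤ min r (rs + δ))
    (hm : ∀ s ∈ Icc (rs - δ) (rs + δ), m ≤ S.b s * S.ρ s * s ^ 2) :
    m * (min r (rs + δ) - (rs - δ)) ≤ S.massShift rs δ r := by
  have h0 := sub_pos.mpr hδ
  calc m * (min r (rs + δ) - (rs - δ)) = ∫ _ in Icc (rs - δ) (min r (rs + δ)), m := by
        rw [MeasureTheory.setIntegral_const, MeasureTheory.measureReal_def, Real.volume_Icc,
          ENNReal.toReal_ofReal (sub_nonneg.mpr hr), smul_eq_mul, mul_comm]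
    _ ≤ S.massShift rs δ r :=
        MeasureTheory.setIntegral_mono_on (continuousOn_const.integrableOn_compact isCompact_Icc)
          (S.integrableOn_source hk h0.le)
          measurableSet_Icc fun s hs => hm s ⟨hs.1, hs.2.trans (min_le_right _ _)⟩

end StaticSolution

/-! ### Positivity of the perturbed a and upper bounds for ∂_v a. -/

/-- Lower bound for the density of a static solution on `[0, R]`. -/
def minDensity (k ρ₀ R : ℝ) : ℝ :=
  ρ₀ * Real.exp (-(IsStaticFluid.decayRate k ρ₀ * R ^ 2))

theorem minDensity_pos {k ρ₀ R : ℝ} (hρ₀ : 0 < ρ₀) : 0 < minDensity k ρ₀ R := by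
  unfold minDensity
  positivity

theorem IsStaticFluid.minDensity_le {k ρ₀ R : ℝ} {a b ρ : ℝ → ℝ} (F : IsStaticFluid k ρ₀ a b ρ)
    (hk : 0 < k) (hk1 : k < 1) (hρ₀ : 0 < ρ₀) {r : ℝ} (hr : 0 ≤ r) (hrR : r ≤ R) :
    minDensity k ρ₀ R ≤ ρ r := by
  refine le_trans ?_ (F.le_ρ hk hk1 hr)
  unfold minDensity decayRate
  have := Real.pi_pos
  gcongr

namespace StaticSolution

variable {k ρ₀ : ℝ} (S : StaticSolution k ρ₀)

theorem perturbed_a_le (hk : 0 < k) (hk1 : k < 1) {rs δ h r : ℝ} (hδ : δ < rs) (hh : 0 < h)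
    (hr : 0 ≤ r) : (S.data.perturbed k rs δ h).a r ≤ S.a r := by
  rcases hr.eq_or_lt with rfl | hr
  · rw [perturbed_a_zero, S.a_zero]
  rw [S.perturbed_a hk hδ hh hr]
  have h1 := S.massShift_nonneg (r := r) hδ
  have h2 := S.b_pos r hr.le
  have h3 : 0 ≤ 1 - k ^ 2 := by nlinarith
  have h4 := Real.pi_pos
  have : 0 ≤ 4 * Real.pi * (1 - k ^ 2) / (h * (r * S.b r)) * S.massShift rs δ r := by positivity
  linarith

theorem perturbed_a_pos (hk : 0 < k) (hk1 : k < 1) (hρ₀ : 0 < ρ₀) {rs Δ δ h r : ℝ} (hΔ : Δ < rs)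
    (hδ0 : 0 < δ) (hδ : δ < Δ) (hh : 0 < h)
    (hC : δ / h ≤ 1 / (2048 * Real.pi * ρ₀ * rs ^ 2 / (rs - Δ))) (hr : 0 ≤ r) :
    0 < (S.data.perturbed k rs δ h).a r := by
  rcases hr.eq_or_lt with rfl | hr
  · rw [perturbed_a_zero]
    exact one_pos
  have F := S.isStaticFluid hk.ne'
  have hpi := Real.pi_pos
  have hδrs := hδ.trans hΔ
  have hrs : 0 < rs := hδ0.trans hδrs
  have hl : 0 < rs - Δ := sub_pos.mpr hΔ
  rw [S.perturbed_a hk hδrs hh hr]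
  have ha := F.le_a hk hk1 hr.le
  rcases lt_or_ge r (rs - δ) with hlt | hge
  · have := S.massShift_eq_zero hlt
    rw [massShift] at this
    rw [this]
    linarith
  have hJ := S.massShift_le hk hk1 hδ0 hδrs hρ₀ (r := r)
  have hJ0 := S.massShift_nonneg (r := r) hδrs
  have hb := F.one_le_b hr.le
  have hk2 : 0 < 1 - k ^ 2 := by nlinarith
  have hrb : rs - Δ ≤ r * S.b r := by nlinarith
  have hC' : δ / h * (2048 * Real.pi * ρ₀ * rs ^ 2 / (rs - Δ)) ≤ 1 := by
    rwa [le_div_iff₀ (by positivity)] at hC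
  have hle : 4 * Real.pi * (1 - k ^ 2) / (h * (r * S.b r)) * S.massShift rs δ r ≤
      4 * Real.pi * (1 - k ^ 2) / (h * (rs - Δ)) * (64 * ρ₀ * rs ^ 2 * δ) := by gcongr
  -- The constant 2048 = 4 · 64 · 8 is chosen so that the decrease of a is at most (1 - k²)/8,
  -- strictly below the lower bound 1/8 for a.
  have heq : 4 * Real.pi * (1 - k ^ 2) / (h * (rs - Δ)) * (64 * ρ₀ * rs ^ 2 * δ) =
      (1 - k ^ 2) / 8 * (δ / h * (2048 * Real.pi * ρ₀ * rs ^ 2 / (rs - Δ))) := by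
    field_simp
    ring
  have hfin : (1 - k ^ 2) / 8 * (δ / h * (2048 * Real.pi * ρ₀ * rs ^ 2 / (rs - Δ))) ≤
      (1 - k ^ 2) / 8 * 1 := by gcongr
  have : 0 < k ^ 2 := by positivity
  simp only [massShift] at *
  linarith

theorem perturbed_dva {rs δ h r : ℝ} (hr : 0 < r) :
    (S.data.perturbed k rs δ h).dva k r = 2 * Real.pi * (1 + k ^ 2) * r * S.b r *
      (S.ρ r / S.a r) * ((S.data.perturbed k rs δ h).a r ^ 2 -
        4 * (S.data.perturbed k rs δ h).V r ^ 2) := by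
  rw [← S.data_M hr]
  rfl

theorem perturbed_dva_eq_zero (hk : 0 < k) {rs δ h r : ℝ} (hδ : δ < rs)
    (hh : 0 < h) (hr : 0 ≤ r) (hlt : r < rs - δ) : (S.data.perturbed k rs δ h).dva k r = 0 := by
  rcases hr.eq_or_lt with rfl | hr
  · simp [SliceData.dva]
  have h1 := S.massShift_eq_zero hlt
  rw [massShift] at h1
  rw [S.perturbed_dva hr, S.perturbed_a hk hδ hh hr, h1, S.perturbed_V hr,
    indicator_of_notMem fun h => absurd h.1 (not_le.mpr hlt)]
  ring

theorem perturbed_dva_le_of_mem (hk : 0 < k) (hk1 : k < 1) (hρ₀ : 0 < ρ₀) {rs Δ δ h r : ℝ}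
    (hΔ : Δ < rs) (hδ : δ < Δ) (hh : 0 < h) (hr : r ∈ Icc (rs - δ) (rs + δ))
    (ha0 : 0 < (S.data.perturbed k rs δ h).a r) :
    (S.data.perturbed k rs δ h).dva k r ≤
      -(2 * Real.pi * (1 + k ^ 2) * (rs - Δ) * minDensity k ρ₀ (2 * rs) / 8) * (1 / h ^ 2) := by
  have F := S.isStaticFluid hk.ne'
  have hpi := Real.pi_pos
  have hδrs := hδ.trans hΔ
  have hl : 0 < rs - Δ := sub_pos.mpr hΔ
  have hlr : rs - Δ ≤ r := by linarith [hr.1]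
  have hr0 : 0 < r := hl.trans_le hlr
  have ha1 := S.perturbed_a_le hk hk1 hδrs hh hr0.le
  have ha := F.le_a hk hk1 hr0.le
  have hb := F.one_le_b hr0.le
  have hρ := F.minDensity_le hk hk1 hρ₀ hr0.le (by linarith [hr.2] : r ≤ 2 * rs)
  have hσ := minDensity_pos (k := k) (R := 2 * rs) hρ₀
  have hapos := S.a_pos hr0.le
  rw [S.perturbed_dva hr0, S.perturbed_V hr0, indicator_of_mem hr]
  generalize (S.data.perturbed k rs δ h).a r = a₀ at *
  have hsq : a₀ ^ 2 ≤ S.a r ^ 2 := by gcongr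
  -- Expanding (1 + 1/h)², a² absorbs a₀² and the negative cross term 2/h is discarded.
  have hdiff : a₀ ^ 2 - 4 * (-(S.a r / 2) * (1 + 1 / h)) ^ 2 ≤ -(S.a r ^ 2 * (1 / h ^ 2)) := by
    have : 0 ≤ S.a r ^ 2 * (2 / h) := by positivity
    have e : 4 * (-(S.a r / 2) * (1 + 1 / h)) ^ 2 =
      S.a r ^ 2 + S.a r ^ 2 * (2 / h) + S.a r ^ 2 * (1 / h ^ 2) := by
      field_simp
      ring
    linarith
  generalize minDensity k ρ₀ (2 * rs) = σ at *
  have hρpos := S.ρ_pos r hr0.le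
  have hbpos := S.b_pos r hr0.le
  calc _ ≤ 2 * Real.pi * (1 + k ^ 2) * r * S.b r * (S.ρ r / S.a r) *
        -(S.a r ^ 2 * (1 / h ^ 2)) := by gcongr
    _ = -(2 * Real.pi * (1 + k ^ 2) * r * S.ρ r * (S.a r * S.b r) * (1 / h ^ 2)) := by
        field_simp
    _ ≤ -(2 * Real.pi * (1 + k ^ 2) * (rs - Δ) * σ * (1 / 8 * 1) * (1 / h ^ 2)) := by
        apply neg_le_neg
        gcongr
    _ = _ := by ring

theorem perturbed_dva_le_of_lt (hk : 0 < k) (hk1 : k < 1) {rs δ h r : ℝ}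
    (hδ0 : 0 < δ) (hδ : δ < rs) (hh : 0 < h) (hr : rs + δ < r)
    (ha0 : 0 < (S.data.perturbed k rs δ h).a r) :
    (S.data.perturbed k rs δ h).dva k r ≤ -(2 * Real.pi * (1 + k ^ 2) *
      (4 * Real.pi * (1 - k ^ 2)) / h * (S.ρ r * S.massShift rs δ r)) := by
  have hpi := Real.pi_pos
  have hr0 : 0 < r := by linarith
  have hk2 : 0 < 1 - k ^ 2 := by nlinarith
  have hapos := S.a_pos hr0.le
  have hρpos := S.ρ_pos r hr0.le
  have hbpos := S.b_pos r hr0.le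
  have hJ := S.massShift_nonneg (r := r) hδ
  rw [S.perturbed_dva hr0, S.perturbed_V hr0,
    indicator_of_notMem fun h => absurd h.2 (not_le.mpr hr)]
  rw [S.perturbed_a hk hδ hh hr0] at ha0 ⊢
  rw [← massShift] at ha0 ⊢
  generalize S.massShift rs δ r = J at *
  set d := 4 * Real.pi * (1 - k ^ 2) / (h * (r * S.b r)) * J with hd
  have hd0 : 0 ≤ d := by positivity
  -- The left side is -d(2a - d), and positivity of the perturbed coefficient gives d < a.
  have hdiff : (S.a r - d) ^ 2 - 4 * (-(S.a r / 2) * (1 + 0)) ^ 2 ≤ -(d * S.a r) := by nlinarith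
  calc _ ≤ 2 * Real.pi * (1 + k ^ 2) * r * S.b r * (S.ρ r / S.a r) * -(d * S.a r) := by gcongr
    _ = _ := by
        rw [hd]
        field_simp

theorem le_source (hk : 0 < k) (hk1 : k < 1) (hρ₀ : 0 < ρ₀) {rs Δ s : ℝ} (hΔ : Δ < rs)
    (hs1 : rs - Δ ≤ s) (hs2 : s ≤ 2 * rs) :
    minDensity k ρ₀ (2 * rs) * (rs - Δ) ^ 2 ≤ S.b s * S.ρ s * s ^ 2 := by
  have F := S.isStaticFluid hk.ne'
  have hl : 0 < rs - Δ := sub_pos.mpr hΔ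
  have hs0 : 0 ≤ s := hl.le.trans hs1
  have hσ := minDensity_pos (k := k) (R := 2 * rs) hρ₀
  have hρ := F.minDensity_le hk hk1 hρ₀ hs0 hs2
  have hb := F.one_le_b hs0
  have hbpos := S.b_pos s hs0
  have hρpos := S.ρ_pos s hs0
  calc _ = 1 * minDensity k ρ₀ (2 * rs) * (rs - Δ) ^ 2 := by ring
    _ ≤ _ := by gcongr

end StaticSolution

end EinsteinEuler

end

/-! ### Choice of the constants and conclusion. -/

theorem mainTheorem1 (k ρ₀ rs Δ : ℝ) (hk : 0 < k) (hk1 : k < 1) (hρ₀ : 0 < ρ₀)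
    (hrs : 0 < rs) (hΔ : 0 < Δ) (hΔrs : Δ < rs) :
    ∃ C₁ C₂ C₃ C₄ : ℝ, 0 < C₁ ∧ 0 < C₂ ∧ 0 < C₃ ∧ 0 < C₄ ∧
      (∀ (S : EinsteinEuler.StaticSolution k ρ₀) (δ h : ℝ),
        0 < δ → δ < Δ → 0 < h → δ / h ≤ 1 / C₁ →
        (∀ r, 0 ≤ r →
          0 < (S.data.perturbed k rs δ h).a r ∧ (S.data.perturbed k rs δ h).a r ≤ S.data.a r) ∧
        ¬ (S.data.perturbed k rs δ h).HasTrappedSurface ∧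
        (∀ r, 0 ≤ r → r < rs - δ → (S.data.perturbed k rs δ h).dva k r = 0) ∧
        (∀ r, rs - δ < r → (S.data.perturbed k rs δ h).dva k r < 0) ∧
        (∀ r, rs - δ ≤ r → r ≤ rs + δ →
          (S.data.perturbed k rs δ h).dva k r ≤ -C₂ * (δ / h ^ 3)) ∧
        (∀ r, rs - δ ≤ r → r ≤ rs + δ →
          (S.data.perturbed k rs δ h).dva k r ≤ -C₄ * (1 / h ^ 2)) ∧
        (∀ r, rs + δ < r → r ≤ rs + Δ →
          (S.data.perturbed k rs δ h).dva k r ≤ -C₃ * (δ / h))) ∧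
      (∀ N : ℝ, ∃ δ h : ℝ, 0 < δ ∧ δ < Δ ∧ 0 < h ∧ δ / h ≤ 1 / C₁ ∧
        ∀ (S : EinsteinEuler.StaticSolution k ρ₀) (r : ℝ), rs - δ ≤ r → r ≤ rs + δ →
          (S.data.perturbed k rs δ h).dva k r ≤ -N) := by
  have hpi := Real.pi_pos
  have hl : 0 < rs - Δ := sub_pos.mpr hΔrs
  have hk2 : 0 < 1 - k ^ 2 := by nlinarith
  have hσ := EinsteinEuler.minDensity_pos (k := k) (R := 2 * rs) hρ₀
  set σ := EinsteinEuler.minDensity k ρ₀ (2 * rs) with hσdef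
  set C₁ := 2048 * Real.pi * ρ₀ * rs ^ 2 / (rs - Δ) with hC₁
  set C₄ := 2 * Real.pi * (1 + k ^ 2) * (rs - Δ) * σ / 8 with hC₄
  have hC₁pos : 0 < C₁ := by positivity
  have hC₄pos : 0 < C₄ := by positivity
  have hapos : ∀ (S : EinsteinEuler.StaticSolution k ρ₀) (δ h : ℝ), 0 < δ → δ < Δ → 0 < h →
      δ / h ≤ 1 / C₁ → ∀ r, 0 ≤ r → 0 < (S.data.perturbed k rs δ h).a r :=
    fun S δ h hδ0 hδ hh hC r hr => S.perturbed_a_pos hk hk1 hρ₀ hΔrs hδ0 hδ hh hC hr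
  have hmem : ∀ (S : EinsteinEuler.StaticSolution k ρ₀) (δ h : ℝ), 0 < δ → δ < Δ → 0 < h →
      δ / h ≤ 1 / C₁ → ∀ r, rs - δ ≤ r → r ≤ rs + δ →
      (S.data.perturbed k rs δ h).dva k r ≤ -C₄ * (1 / h ^ 2) :=
    fun S δ h hδ0 hδ hh hC r hr1 hr2 => S.perturbed_dva_le_of_mem hk hk1 hρ₀ hΔrs hδ hh ⟨hr1, hr2⟩
      (hapos S δ h hδ0 hδ hh hC r (by linarith))
  -- The choice C₂ = C₄C₁ makes the δ/h³ bound a consequence of the 1/h² bound, because C₁δ/h ≤ 1.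
  refine ⟨C₁, C₄ * C₁, 2 * Real.pi * (1 + k ^ 2) * (4 * Real.pi * (1 - k ^ 2)) *
    (σ * (σ * (rs - Δ) ^ 2 * 2)), C₄, hC₁pos, by positivity, by positivity, hC₄pos, ?_, ?_⟩
  · intro S δ h hδ0 hδ hh hC
    have hδrs := hδ.trans hΔrs
    have hJ : ∀ r, rs + δ < r → σ * (rs - Δ) ^ 2 * (2 * δ) ≤ S.massShift rs δ r := by
      intro r hr
      have hmin : min r (rs + δ) = rs + δ := min_eq_right hr.le
      have := S.le_massShift hk (r := r) (m := σ * (rs - Δ) ^ 2) hδrs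
        (by rw [hmin]; linarith) fun s hs =>
          S.le_source hk hk1 hρ₀ hΔrs (by linarith [hs.1]) (by linarith [hs.2])
      rw [hmin] at this
      linarith
    have hout : ∀ r, rs + δ < r → (S.data.perturbed k rs δ h).dva k r ≤
        -(2 * Real.pi * (1 + k ^ 2) * (4 * Real.pi * (1 - k ^ 2)) / h *
          (S.ρ r * S.massShift rs δ r)) := fun r hr =>
      S.perturbed_dva_le_of_lt hk hk1 hδ0 hδrs hh hr
        (hapos S δ h hδ0 hδ hh hC r (by linarith))
    refine ⟨fun r hr => ⟨hapos S δ h hδ0 hδ hh hC r hr, S.perturbed_a_le hk hk1 hδrs hh hr⟩,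
      fun ⟨r, hr, hneg⟩ => absurd hneg (hapos S δ h hδ0 hδ hh hC r hr.le).not_gt,
      fun r hr hlt => S.perturbed_dva_eq_zero hk hδrs hh hr hlt, fun r hr => ?_,
      fun r hr1 hr2 => ?_, hmem S δ h hδ0 hδ hh hC, fun r hr1 hr2 => ?_⟩
    · rcases le_or_gt r (rs + δ) with hle | hlt
      · refine (hmem S δ h hδ0 hδ hh hC r hr.le hle).trans_lt ?_
        have : 0 < C₄ * (1 / h ^ 2) := by positivity
        linarith
      · refine (hout r hlt).trans_lt ?_
        have h1 : 0 < S.massShift rs δ r := lt_of_lt_of_le (by positivity) (hJ r hlt)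
        have h2 := S.ρ_pos r (by linarith)
        exact neg_lt_zero.mpr (by positivity)
    · refine (hmem S δ h hδ0 hδ hh hC r hr1 hr2).trans ?_
      rw [le_div_iff₀ hC₁pos] at hC
      have e : C₄ * C₁ * (δ / h ^ 3) = C₄ * (1 / h ^ 2) * (δ / h * C₁) := by
        field_simp
      have : C₄ * (1 / h ^ 2) * (δ / h * C₁) ≤ C₄ * (1 / h ^ 2) * 1 := by gcongr
      linarith
    · refine (hout r hr1).trans ?_
      have h1 := hJ r hr1
      have h2 := (S.isStaticFluid hk.ne').minDensity_le hk hk1 hρ₀ (by linarith : 0 ≤ r)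
        (by linarith : r ≤ 2 * rs)
      have h3 : 2 * Real.pi * (1 + k ^ 2) * (4 * Real.pi * (1 - k ^ 2)) / h *
          (σ * (σ * (rs - Δ) ^ 2 * (2 * δ))) ≤
          2 * Real.pi * (1 + k ^ 2) * (4 * Real.pi * (1 - k ^ 2)) / h *
          (S.ρ r * S.massShift rs δ r) := by
        gcongr
        exact hσ.le.trans h2
      refine (neg_le_neg h3).trans (le_of_eq ?_)
      ring
  · intro N
    -- This h makes C₄/h² equal to |N| + 1; δ is then taken small enough to satisfy both δ < Δ and
    -- the smallness condition on δ/h.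
    set h := Real.sqrt (C₄ / (|N| + 1)) with hh
    have hN : 0 < |N| + 1 := by positivity
    have hhpos : 0 < h := Real.sqrt_pos.mpr (by positivity)
    have hδpos : 0 < min (Δ / 2) (h / C₁) := by positivity
    have hδΔ : min (Δ / 2) (h / C₁) < Δ := (min_le_left _ _).trans_lt (by linarith)
    have hδC : min (Δ / 2) (h / C₁) / h ≤ 1 / C₁ := by
      rw [div_le_iff₀ hhpos]
      exact (min_le_right _ _).trans_eq (by ring)
    refine ⟨min (Δ / 2) (h / C₁), h, hδpos, hδΔ, hhpos, hδC, fun S r hr1 hr2 => ?_⟩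
    refine (hmem S _ h hδpos hδΔ hhpos hδC r hr1 hr2).trans ?_
    have hsq : h ^ 2 = C₄ / (|N| + 1) := Real.sq_sqrt (by positivity)
    have : C₄ * (1 / h ^ 2) = |N| + 1 := by
      rw [hsq]
      field_simp
    linarith [le_abs_self N]
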